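/- Let $k\ge 1$, $m\ge 2$, $n\ge 0$, and let $H_1,\dots,H_k$ be cliques, $H_i=K_{r_i}$ with $r_i\ge 1$. For graphs $H,G$ let $\mathcal N(H,G)$ be the number of (not necessarily induced) subgraphs of $G$ isomorphic to $H$. For a graph $G$ whose edges are colored with colors $1,\dots,k$ (arbitrarily, so adjacent edges may share a color), let $G_i$ be the spanning subgraph of $G$ formed by the edges of color $i$, and put $$\mathcal N^{\mathrm{col}}(H_1,\dots,H_k;G)=\sum_{i=1}^k\mathcal N(H_i,G_i).$$ Let $T_{m-1}(n)$ be the Turán graph: the complete $(m-1)$-partite graph on $n$ vertices whose parts have sizes $\lfloor n/(m-1)\rfloor$ or $\lceil n/(m-1)\rceil$. Then, for every $n$, among all $k$-edge-colored $K_m$-free graphs $G$ on $n$ vertices, the quantity $\mathcal N^{\mathrm{col}}(H_1,\dots,H_k;G)$ is maximized by a monochromatic $T_{m-1}(n)$: there is a color $i$ such that $T_{m-1}(n)$, which is $K_m$-free, attains the maximum when all its edges are given color $i$. If moreover every $r_i\ge 2$, then the tuple $(H_1,\dots,H_k,K_m)$ is color-resistant for every $n$, i.e. $$\mathrm{ex}^{\mathrm{col}}(n,(H_1,\dots,H_k),K_m)=\max_{1\le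 i\le k}\mathrm{ex}(n,H_i,K_m),$$ where $\mathrm{ex}^{\mathrm{col}}(n,(H_1,\dots,H_k),K_m)$ is the largest value of $\mathcal N^{\mathrm{col}}(H_1,\dots,H_k;G)$ over $k$-edge-colored $K_m$-free graphs $G$ on $n$ vertices, and $\mathrm{ex}(n,H_i,K_m)$ is the largest value of $\mathcal N(H_i,G)$ over (uncolored) $K_m$-free graphs $G$ on $n$ vertices. -/

import Mathlib

namespace ColoredTuran

open SimpleGraph

universe u v w

/-- `N^col(H₁, …, H_k; G)`: the sum over the colors `i` of the number of (not necessarily induced)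
subgraphs isomorphic to `H i` of the spanning subgraph `G_i` formed by the edges of color `i`. -/
noncomputable def coloredCount {k : ℕ} {W : Fin k → Type w} (H : ∀ i, SimpleGraph (W i))
    {V : Type v} [Fintype V] {G : SimpleGraph V} (c : G.EdgeLabeling (Fin k)) : ℕ :=
  ∑ i, (c.labelGraph i).copyCount (H i)

/-- The coloring of `G` in which every edge has color `i`. -/
def monochromatic {k : ℕ} {V : Type v} (G : SimpleGraph V) (i : Fin k) :
    G.EdgeLabeling (Fin k) :=
  fun _ => i

/-- The numbers of copies of `H` in `F`-free graphs on `n` vertices. -/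
def exValues (n : ℕ) {W : Type w} (H : SimpleGraph W) {U : Type u} (F : SimpleGraph U) : Set ℕ :=
  {x | ∃ G : SimpleGraph (Fin n), F.Free G ∧ G.copyCount H = x}

/-- `ex(n, H, F)`: the largest number of copies of `H` in an `F`-free graph on `n` vertices. -/
noncomputable def ex (n : ℕ) {W : Type w} (H : SimpleGraph W) {U : Type u} (F : SimpleGraph U) :
    ℕ :=
  sSup (exValues n H F)

/-- The values `N^col(H₁, …, H_k; G)` over `k`-edge-colored `F`-free graphs on `n` vertices. -/
def cexValues (n : ℕ) {k : ℕ} {W : Fin k → Type w} (H : ∀ i, SimpleGraph (W i))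
    {U : Type u} (F : SimpleGraph U) : Set ℕ :=
  {x | ∃ (G : SimpleGraph (Fin n)) (c : G.EdgeLabeling (Fin k)),
    F.Free G ∧ coloredCount H c = x}

/-- `ex^col(n, (H₁, …, H_k), F)`: the largest value of `N^col(H₁, …, H_k; G)` over
`k`-edge-colored `F`-free graphs `G` on `n` vertices. -/
noncomputable def cex (n : ℕ) {k : ℕ} {W : Fin k → Type w} (H : ∀ i, SimpleGraph (W i))
    {U : Type u} (F : SimpleGraph U) : ℕ :=
  sSup (cexValues n H F)

/-- Both sets of values are finite, so that the suprema above are maxima (of nonempty sets). -/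
theorem exValues_finite (n : ℕ) {W : Type w} (H : SimpleGraph W) {U : Type u}
    (F : SimpleGraph U) : (exValues n H F).Finite := by
  refine (Set.finite_range (fun G : SimpleGraph (Fin n) => G.copyCount H)).subset ?_
  rintro x ⟨G, -, rfl⟩
  exact ⟨G, rfl⟩

theorem cexValues_finite (n : ℕ) {k : ℕ} {W : Fin k → Type w} (H : ∀ i, SimpleGraph (W i))
    {U : Type u} (F : SimpleGraph U) : (cexValues n H F).Finite := by
  refine (Set.finite_range (fun p : Σ G : SimpleGraph (Fin n), G.EdgeLabeling (Fin k) =>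
    coloredCount H p.2)).subset ?_
  rintro x ⟨G, c, -, rfl⟩
  exact ⟨⟨G, c⟩, rfl⟩

/-- The tuple `(H₁, …, H_k, F)` is color-resistant for `n`:
`ex^col(n, (H₁, …, H_k), F) = max_{i ≤ k} ex(n, H_i, F)`. -/
def IsColorResistant (n : ℕ) {k : ℕ} {W : Fin k → Type w} (H : ∀ i, SimpleGraph (W i))
    {U : Type u} (F : SimpleGraph U) : Prop :=
  cex n H F = Finset.univ.sup (fun i => ex n (H i) F)

end ColoredTuran

/-! Write `t = m - 1`, `T` for the Turán graph and `k_r` for the number of `r`-cliques. The key fact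
(`card_cliqueFinset_mul_le`) is that a `K_{t+1}`-free graph has at most as many `r`-cliques per edge
as `T`: `k_r(G) * k_2(T) ≤ k_2(G) * k_r(T)` for `r ≥ 2`. Each color class is itself `K_{t+1}`-free.
Summing the bound over colors with `r_j ≥ 2`, with `k_{r_j}(T)` replaced by its maximum `M`, gives
at most `M * e(G) / e(T) ≤ M`, since the classes partition the edges and `e(G) ≤ e(T)`. A color with
`r_j = 1` always contributes `n`.

For the key fact, Zykov symmetrization (`exists_isClique_support`) moves vertex weights onto a
clique of at most `t` vertices without decreasing `k_2(T) * k_r - k_r(T) * k_2`. There clique counts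
are elementary symmetric functions of the weights, and balancing the weights increases the ratio
`e_r / e_2` (`esymm_le_of_isBalanced`). -/

namespace Multiset

/-! ### Elementary symmetric functions and balancing. -/

theorem esymm_zero_right (s : Multiset ℕ) : s.esymm 0 = 1 := by
  simp [esymm]

theorem esymm_cons_succ (a : ℕ) (s : Multiset ℕ) (q : ℕ) :
    (a ::ₘ s).esymm (q + 1) = s.esymm (q + 1) + a * s.esymm q := by
  simp [esymm, Multiset.sum_map_mul_left]

theorem esymm_zero_cons (s : Multiset ℕ) (q : ℕ) : (0 ::ₘ s).esymm q = s.esymm q := by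
  cases q with
  | zero => simp [esymm_zero_right]
  | succ q => simp [esymm_cons_succ]

theorem esymm_add_replicate_zero (s : Multiset ℕ) (c q : ℕ) :
    (s + replicate c 0).esymm q = s.esymm q := by
  induction c with
  | zero => simp
  | succ c ih => rw [replicate_succ, add_cons, esymm_zero_cons, ih]

theorem esymm_cons_cons (a b : ℕ) (s : Multiset ℕ) (q : ℕ) :
    (a ::ₘ b ::ₘ s).esymm (q + 2) =
      s.esymm (q + 2) + (a + b) * s.esymm (q + 1) + a * b * s.esymm q := by
  simp only [esymm_cons_succ]
  ring

/-- Every `(p + q)`-subset splits into a `p`-subset and a `q`-subset, and the pair determines it. -/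
theorem esymm_add_le_mul (s : Multiset ℕ) (p q : ℕ) :
    s.esymm (p + q) ≤ s.esymm p * s.esymm q := by
  induction s using Multiset.induction_on generalizing p q with
  | empty =>
    cases p <;> cases q <;> simp [esymm, powersetCard_zero_right, ← add_assoc]
  | cons a s ih =>
    cases p with
    | zero => simp [esymm_zero_right]
    | succ p =>
      cases q with
      | zero => simp [esymm_zero_right]
      | succ q =>
        have h : p + 1 + (q + 1) = (p + 1 + q) + 1 := by ring
        rw [h, esymm_cons_succ, esymm_cons_succ, esymm_cons_succ, ← h]
        have h1 := ih (p + 1) (q + 1)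
        have h2 := Nat.mul_le_mul_left a (ih (p + 1) q)
        nlinarith [Nat.zero_le (a * s.esymm p * s.esymm (q + 1)),
          Nat.zero_le (a * s.esymm p * (a * s.esymm q))]

/-- With the sum fixed, both functions are affine in the product of the two entries.
Cross-multiplying leaves `e_{q+2} + (c+d) e_{q+1} ≤ e_q (e_2 + (c+d) e_1)` in the `e_i` of `s`. -/
theorem esymm_mul_esymm_two_le_of_mul_le (s : Multiset ℕ) {a b c d : ℕ} (hs : a + b = c + d)
    (hp : a * b ≤ c * d) (q : ℕ) :
    (a ::ₘ b ::ₘ s).esymm (q + 2) * (c ::ₘ d ::ₘ s).esymm 2 ≤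
      (a ::ₘ b ::ₘ s).esymm 2 * (c ::ₘ d ::ₘ s).esymm (q + 2) := by
  have e1 := esymm_add_le_mul s q 2
  have e2 := esymm_add_le_mul s q 1
  have h2 := fun x y => esymm_cons_cons x y s 0
  simp only [zero_add, esymm_zero_right, mul_one] at h2
  rw [esymm_cons_cons a b s q, esymm_cons_cons c d s q, h2, h2, hs]
  obtain ⟨w, hw⟩ := Nat.exists_eq_add_of_le hp
  rw [hw]
  have e3 : s.esymm (q + 2) + (c + d) * s.esymm (q + 1) ≤
      s.esymm q * (s.esymm 2 + (c + d) * s.esymm 1) := by nlinarith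
  nlinarith [Nat.mul_le_mul_left w e3]

theorem esymm_two_le_of_mul_le (s : Multiset ℕ) {a b c d : ℕ} (hs : a + b = c + d)
    (hp : a * b ≤ c * d) :
    (a ::ₘ b ::ₘ s).esymm 2 ≤ (c ::ₘ d ::ₘ s).esymm 2 := by
  rw [esymm_cons_cons _ _ _ 0, esymm_cons_cons _ _ _ 0, hs]
  gcongr

theorem eq_replicate_add_replicate (s : Multiset ℕ) (a : ℕ) (h : ∀ x ∈ s, x = a ∨ x = a + 1) :
    s = replicate (card s * (a + 1) - s.sum) a + replicate (s.sum - card s * a) (a + 1) := by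
  have key : ∃ p q, s = replicate p a + replicate q (a + 1) := by
    induction s using Multiset.induction_on with
    | empty => exact ⟨0, 0, by simp⟩
    | cons x s ih =>
      obtain ⟨p, q, hpq⟩ := ih fun y hy => h y (mem_cons_of_mem hy)
      rcases h x (mem_cons_self x s) with rfl | rfl
      · exact ⟨p + 1, q, by rw [hpq, replicate_succ, cons_add]⟩
      · exact ⟨p, q + 1, by rw [hpq, replicate_succ, add_cons]⟩
  obtain ⟨p, q, rfl⟩ := key
  have h1 : (p + q) * (a + 1) - (p * a + q * (a + 1)) = p := by
    rw [Nat.sub_eq_iff_eq_add (by nlinarith)]; ring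
  have h2 : (p * a + q * (a + 1)) - (p + q) * a = q := by
    rw [Nat.sub_eq_iff_eq_add (by nlinarith)]; ring
  simp [h1, h2]

/-- Any two entries differ by at most one. -/
def IsBalanced (s : Multiset ℕ) : Prop := ∀ x ∈ s, ∀ y ∈ s, x ≤ y + 1

theorem IsBalanced.exists_forall_eq_div {s : Multiset ℕ} (h : s.IsBalanced) :
    ∀ x ∈ s, x = s.sum / card s ∨ x = s.sum / card s + 1 := by
  intro x hx
  obtain ⟨a, ha, hmin⟩ : ∃ a ∈ s, ∀ y ∈ s, a ≤ y := by
    have hne : s.toFinset.Nonempty := ⟨x, by simpa using hx⟩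
    exact ⟨s.toFinset.min' hne, by simpa using s.toFinset.min'_mem hne,
      fun y hy => s.toFinset.min'_le y (by simpa using hy)⟩
  -- Splitting off one copy of the minimum makes the upper bound `s.sum < card s * (a + 1)` strict.
  have hdiv : s.sum / card s = a := by
    obtain ⟨s', rfl⟩ := exists_cons_of_mem ha
    have h1 : card s' • a ≤ s'.sum := card_nsmul_le_sum fun y hy => hmin y (mem_cons_of_mem hy)
    have h2 : s'.sum ≤ card s' • (a + 1) :=
      sum_le_card_nsmul _ _ fun y hy => h y (mem_cons_of_mem hy) a ha
    simp only [smul_eq_mul] at h1 h2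
    simp only [sum_cons, card_cons]
    apply Nat.div_eq_of_lt_le <;> nlinarith
  rw [hdiv]
  have := hmin x hx
  have := h x hx a ha
  omega

theorem IsBalanced.unique {s u : Multiset ℕ} (hs : s.IsBalanced) (hu : u.IsBalanced)
    (hc : card s = card u) (hsum : s.sum = u.sum) : s = u := by
  rw [eq_replicate_add_replicate s _ hs.exists_forall_eq_div,
    eq_replicate_add_replicate u _ hu.exists_forall_eq_div, hc, hsum]

/-- Smoothing: moving one unit from a larger entry to one smaller by at least two lowers the sum of
squares, and ends at the unique balanced multiset. -/
theorem esymm_le_of_isBalanced {u : Multiset ℕ} (hu : u.IsBalanced) (q : ℕ) (s : Multiset ℕ)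
    (hc : card s = card u) (hsum : s.sum = u.sum) :
    s.esymm 2 ≤ u.esymm 2 ∧
      s.esymm (q + 2) * u.esymm 2 ≤ s.esymm 2 * u.esymm (q + 2) := by
  induction hN : (s.map fun x => x ^ 2).sum using Nat.strong_induction_on generalizing s with
  | _ N ih =>
    by_cases hs : s.IsBalanced
    · rw [hs.unique hu hc hsum]
      exact ⟨le_rfl, (mul_comm _ _).le⟩
    · simp only [IsBalanced, not_forall, not_le] at hs
      obtain ⟨x, hx, y, hy, hxy⟩ := hs
      obtain ⟨s₁, rfl⟩ := exists_cons_of_mem hx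
      obtain ⟨s', rfl⟩ := exists_cons_of_mem ((mem_cons.1 hy).resolve_left (by omega))
      obtain ⟨z, rfl⟩ := Nat.exists_eq_add_of_lt hxy
      have hlt : ((((y + 1 + z) ::ₘ (y + 1) ::ₘ s').map fun x => x ^ 2).sum) < N := by
        rw [← hN]
        simp only [map_cons, sum_cons]
        nlinarith
      have hs : (y + 1 + z + 1) + y = (y + 1 + z) + (y + 1) := by ring
      have hp : (y + 1 + z + 1) * y ≤ (y + 1 + z) * (y + 1) := by nlinarith
      obtain ⟨h1, h2⟩ := ih _ hlt ((y + 1 + z) ::ₘ (y + 1) ::ₘ s') (by simpa using hc)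
        (by rw [← hsum]; simp only [sum_cons]; ring) rfl
      have h3 := esymm_two_le_of_mul_le s' hs hp
      have h4 := esymm_mul_esymm_two_le_of_mul_le s' hs hp q
      -- Both new entries are positive, so the intermediate `e_2` can be cancelled when chaining the
      -- ratios.
      have hpos : 0 < ((y + 1 + z) ::ₘ (y + 1) ::ₘ s').esymm 2 := by
        rw [esymm_cons_cons _ _ _ 0, esymm_zero_right]; positivity
      refine ⟨h3.trans h1, Nat.le_of_mul_le_mul_right ?_ hpos⟩
      calc _ = (_ * _) * u.esymm 2 := mul_right_comm _ _ _
        _ ≤ (_ * _) * u.esymm 2 := Nat.mul_le_mul_right _ h4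
        _ = _ * (_ * _) := mul_assoc _ _ _
        _ ≤ _ * (_ * _) := Nat.mul_le_mul_left _ h2
        _ = _ := by ring

end Multiset

/-! ### Zykov symmetrization of weighted clique counts. -/

namespace SimpleGraph

open Finset Function

variable {V : Type*} [Fintype V] [DecidableEq V] (G : SimpleGraph V) [DecidableRel G.Adj]

/-- The number of `r`-cliques of `G`, each counted with the product of its vertex weights. -/
def weightedCliqueCount (r : ℕ) (x : V → ℕ) : ℕ :=
  ∑ S ∈ G.cliqueFinset r, ∏ v ∈ S, x v

theorem weightedCliqueCount_one (r : ℕ) :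
    G.weightedCliqueCount r (fun _ => 1) = #(G.cliqueFinset r) := by
  simp [weightedCliqueCount]

/-- No clique contains both `u` and `v`, so there is no `p * q` term. -/
theorem exists_weightedCliqueCount_eq_linear (r : ℕ) (x : V → ℕ) {u v : V} (huv : u ≠ v)
    (hadj : ¬ G.Adj u v) :
    ∃ z a b : ℕ, ∀ p q, G.weightedCliqueCount r (update (update x u p) v q) =
      z + p * a + q * b := by
  suffices H : ∀ S ∈ G.cliqueFinset r, ∃ z a b : ℕ, ∀ p q,
      ∏ w ∈ S, update (update x u p) v q w = z + p * a + q * b by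
    choose! z a b h using H
    refine ⟨∑ S ∈ G.cliqueFinset r, z S, ∑ S ∈ G.cliqueFinset r, a S,
      ∑ S ∈ G.cliqueFinset r, b S, fun p q => ?_⟩
    rw [weightedCliqueCount, sum_congr rfl fun S hS => h S hS p q]
    simp only [sum_add_distrib, mul_sum]
  intro S hS
  have hcl := (G.mem_cliqueFinset_iff.1 hS).isClique
  by_cases hv : v ∈ S
  · have hu : u ∉ S := fun hu => hadj (hcl hu hv huv)
    refine ⟨0, 0, ∏ w ∈ S \ {v}, x w, fun p q => ?_⟩
    rw [prod_update_of_mem hv, prod_update_of_notMem (by simp [hu])]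
    ring
  · by_cases hu : u ∈ S
    · refine ⟨0, ∏ w ∈ S \ {u}, x w, 0, fun p q => ?_⟩
      rw [prod_update_of_notMem hv, prod_update_of_mem hu]
      ring
    · refine ⟨∏ w ∈ S, x w, 0, 0, fun p q => ?_⟩
      rw [prod_update_of_notMem hv, prod_update_of_notMem hu]
      ring

theorem sum_update_update (x : V → ℕ) {u v : V} (huv : u ≠ v) {p q : ℕ}
    (h : p + q = x u + x v) : ∑ w, update (update x u p) v q w = ∑ w, x w := by
  have hu : u ∈ univ \ {v} := by simp [huv]
  rw [sum_update_of_mem (mem_univ v), sum_update_of_mem hu, ← add_assoc, add_comm q p, h,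
    ← sum_sdiff (subset_univ {v}), ← sum_sdiff (singleton_subset_iff.2 hu)]
  simp
  ring

/-- Symmetrization: moving weight between nonadjacent vertices, the weights can be concentrated on
a clique without decreasing `a * k_r - b * k_s`. -/
theorem exists_isClique_support (a b r s : ℕ) (x : V → ℕ) :
    ∃ y : V → ℕ, ∑ w, y w = ∑ w, x w ∧ G.IsClique {w | y w ≠ 0} ∧
      a * G.weightedCliqueCount r x + b * G.weightedCliqueCount s y ≤
        a * G.weightedCliqueCount r y + b * G.weightedCliqueCount s x := by
  induction hN : #{w | x w ≠ 0} using Nat.strong_induction_on generalizing x with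
  | _ N ih =>
    by_cases hcl : G.IsClique {w | x w ≠ 0}
    · exact ⟨x, rfl, hcl, le_rfl⟩
    · simp only [isClique_iff, Set.Pairwise, not_forall] at hcl
      obtain ⟨u, hu, v, hv, huv, hadj⟩ := hcl
      simp only [Set.mem_ofPred_eq] at hu hv
      obtain ⟨z₁, a₁, b₁, h₁⟩ := G.exists_weightedCliqueCount_eq_linear r x huv hadj
      obtain ⟨z₂, a₂, b₂, h₂⟩ := G.exists_weightedCliqueCount_eq_linear s x huv hadj
      have hx : update (update x u (x u)) v (x v) = x := by simp
      have step : ∀ p q, p + q = x u + x v → (p = 0 ∨ q = 0) →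
          a * G.weightedCliqueCount r x +
              b * G.weightedCliqueCount s (update (update x u p) v q) ≤
            a * G.weightedCliqueCount r (update (update x u p) v q) +
              b * G.weightedCliqueCount s x →
          ∃ y : V → ℕ, ∑ w, y w = ∑ w, x w ∧ G.IsClique {w | y w ≠ 0} ∧
            a * G.weightedCliqueCount r x + b * G.weightedCliqueCount s y ≤
              a * G.weightedCliqueCount r y + b * G.weightedCliqueCount s x := by
        intro p q hpq h0 hle
        have hlt : #{w | update (update x u p) v q w ≠ 0} < N := by
          rw [← hN]
          apply card_lt_card
          rw [ssubset_iff_of_subset]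
          · rcases h0 with rfl | rfl
            · exact ⟨u, by simpa using hu, by simp [huv]⟩
            · exact ⟨v, by simpa using hv, by simp⟩
          · intro w
            simp only [mem_filter, mem_univ, true_and]
            by_cases hwv : w = v
            · subst hwv; exact fun _ => hv
            · by_cases hwu : w = u
              · subst hwu; exact fun _ => hu
              · simp [hwv, hwu]
        obtain ⟨y, hy, hyc, hyl⟩ := ih _ hlt (update (update x u p) v q) rfl
        exact ⟨y, hy.trans (sum_update_update x huv hpq), hyc, by omega⟩
      have e₁ := h₁ (x u) (x v)
      have e₂ := h₂ (x u) (x v)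
      rw [hx] at e₁ e₂
      -- This compares the slopes `a * a₁ - b * a₂` at `u` and `a * b₁ - b * b₂` at `v`; all the
      -- weight goes to the vertex with the larger slope.
      rcases le_total (a * a₁ + b * b₂) (a * b₁ + b * a₂) with h | h
      · apply step 0 (x u + x v) (by ring) (Or.inl rfl)
        rw [e₁, e₂, h₁, h₂]
        nlinarith [Nat.mul_le_mul_left (x u) h]
      · apply step (x u + x v) 0 (by ring) (Or.inr rfl)
        rw [e₁, e₂, h₁, h₂]
        nlinarith [Nat.mul_le_mul_left (x v) h]

theorem weightedCliqueCount_eq_esymm (r : ℕ) (y : V → ℕ) (S : Finset V)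
    (hS : G.IsClique S) (hy : ∀ v, v ∉ S → y v = 0) :
    G.weightedCliqueCount r y = (S.val.map y).esymm r := by
  rw [Finset.esymm_map_val, weightedCliqueCount]
  symm
  apply sum_subset
  · intro U hU
    rw [mem_powersetCard] at hU
    exact G.mem_cliqueFinset_iff.2 ⟨hS.subset (by exact_mod_cast hU.1), hU.2⟩
  · intro U hU hU'
    have hcard := (G.mem_cliqueFinset_iff.1 hU).card_eq
    obtain ⟨v, hvU, hvS⟩ := not_subset.1 fun h => hU' (mem_powersetCard.2 ⟨h, hcard⟩)
    exact prod_eq_zero hvU (hy v hvS)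

variable {G}

theorem CliqueFree.card_cliqueFinset_le {t : ℕ} (hG : G.CliqueFree (t + 1)) {u : Multiset ℕ}
    (hu : u.IsBalanced) (hc : Multiset.card u = t) (hsum : u.sum = Fintype.card V) (q : ℕ) :
    #(G.cliqueFinset 2) ≤ u.esymm 2 ∧
      #(G.cliqueFinset (q + 2)) * u.esymm 2 ≤ #(G.cliqueFinset 2) * u.esymm (q + 2) := by
  have main : ∀ y : V → ℕ, ∑ w, y w = ∑ _w : V, 1 → G.IsClique {w | y w ≠ 0} →
      G.weightedCliqueCount 2 y ≤ u.esymm 2 ∧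
        G.weightedCliqueCount (q + 2) y * u.esymm 2 ≤
          G.weightedCliqueCount 2 y * u.esymm (q + 2) := by
    intro y hy hcl
    set S : Finset V := {w | y w ≠ 0} with hS
    have hcl' : G.IsClique S := by simpa [hS] using hcl
    have hy0 : ∀ v, v ∉ S → y v = 0 := by simp [hS]
    have hSt : #S ≤ t := by
      by_contra! h
      exact hG.mono h S ⟨hcl', rfl⟩
    have hsumS : (S.val.map y).sum = Fintype.card V := by
      have h : ∑ w ∈ S, y w = ∑ w, y w := sum_subset (subset_univ S) fun v _ hv => hy0 v hv
      rw [hy] at h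
      simpa using h
    -- The clique may have fewer than `t` vertices; padding with zeros does not change `esymm`.
    have := Multiset.esymm_le_of_isBalanced hu q (S.val.map y + Multiset.replicate (t - #S) 0)
      (by simp [hc, hSt]) (by simp only [Multiset.sum_add, hsumS, hsum]; simp)
    simpa only [Multiset.esymm_add_replicate_zero,
      ← G.weightedCliqueCount_eq_esymm _ y S hcl' hy0] using this
  simp only [← weightedCliqueCount_one]
  constructor
  · obtain ⟨y, hy, hcl, hle⟩ := G.exists_isClique_support 1 0 2 2 fun _ => 1
    have := (main y hy hcl).1
    omega
  · obtain ⟨y, hy, hcl, hle⟩ :=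
      G.exists_isClique_support (u.esymm 2) (u.esymm (q + 2)) (q + 2) 2 fun _ => 1
    have := (main y hy hcl).2
    linarith

end SimpleGraph

/-! ### Copies of cliques, and cliques of the Turán graph. -/

namespace SimpleGraph

open Finset Function

/-- A complete subgraph is determined by its vertex set. -/
theorem copyCount_top_eq_card_cliqueFinset {V : Type*} [Fintype V] [DecidableEq V]
    (G : SimpleGraph V) [DecidableRel G.Adj] (r : ℕ) :
    G.copyCount (completeGraph (Fin r)) = #(G.cliqueFinset r) := by
  classical
  have hiso : ∀ G' : G.Subgraph, Nonempty (completeGraph (Fin r) ≃g G'.coe) →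
      #G'.verts.toFinset = r ∧ ∀ v w, G'.Adj v w ↔ v ∈ G'.verts ∧ w ∈ G'.verts ∧ v ≠ w := by
    rintro G' ⟨e⟩
    refine ⟨?_, fun v w => ⟨fun h => ⟨G'.edge_vert h, G'.edge_vert h.symm, h.ne⟩, ?_⟩⟩
    · rw [Set.toFinset_card, ← Fintype.card_congr e.toEquiv, Fintype.card_fin]
    · rintro ⟨hv, hw, hvw⟩
      have h : (completeGraph (Fin r)).Adj (e.symm ⟨v, hv⟩) (e.symm ⟨w, hw⟩) := by
        simpa [completeGraph] using hvw
      simpa using e.map_adj_iff.2 h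
  rw [copyCount]
  refine card_bij (fun G' _ => G'.verts.toFinset) ?_ ?_ ?_
  · intro G' hG'
    obtain ⟨h1, h2⟩ := hiso G' (by simpa using hG')
    refine G.mem_cliqueFinset_iff.2 ⟨fun v hv w hw hvw => ?_, h1⟩
    exact ((h2 v w).2 ⟨by simpa using hv, by simpa using hw, hvw⟩).adj_sub
  · intro G₁ h₁ G₂ h₂ h
    have hverts : G₁.verts = G₂.verts := by simpa using h
    have h₁' := (hiso G₁ (by simpa using h₁)).2
    have h₂' := (hiso G₂ (by simpa using h₂)).2
    ext v w
    · rw [hverts]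
    · rw [h₁', h₂', hverts]
  · intro S hS
    have hS' := G.mem_cliqueFinset_iff.1 hS
    refine ⟨(⊤ : G.Subgraph).induce S, ?_, by simp⟩
    simp only [mem_filter, mem_univ, true_and]
    have e : Fin r ≃ ((⊤ : G.Subgraph).induce (S : Set V)).verts :=
      (Fintype.equivFinOfCardEq (by simpa using hS'.card_eq)).symm
    refine ⟨⟨e, ?_⟩⟩
    intro a b
    have ha : (e a : V) ∈ S := (e a).2
    have hb : (e b : V) ∈ S := (e b).2
    have hne : (e a : V) ≠ e b ↔ a ≠ b := by
      rw [Ne, Subtype.coe_inj, e.injective.eq_iff]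
    simp only [Subgraph.coe_adj, Subgraph.induce_adj, Subgraph.top_adj, completeGraph, top_adj]
    rw [← hne]
    exact ⟨fun h => h.2.2.ne, fun h => ⟨ha, hb, hS'.isClique ha hb h⟩⟩

open scoped Classical in
/-- The number of `r`-sets on which `f` is injective. -/
theorem card_filter_injOn_eq_sum_prod {α β : Type*} [Fintype α] [DecidableEq α] [Fintype β]
    [DecidableEq β] (f : α → β) (r : ℕ) :
    #((powersetCard r univ).filter fun U : Finset α => Set.InjOn f U) =
      ∑ S ∈ powersetCard r (univ : Finset β), ∏ s ∈ S, #{v : α | f v = s} := by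
  -- Group the sets by their image `S`; those over `S` are the choices of one preimage for each
  -- point of `S`.
  rw [card_eq_sum_card_fiberwise (f := fun U : Finset α => U.image f)
    (t := powersetCard r (univ : Finset β))]
  · refine sum_congr rfl fun S hS => ?_
    rw [← card_pi]
    symm
    refine card_bij (fun p _ => S.attach.image fun s => p s.1 s.2) ?_ ?_ ?_
    · intro p hp
      have hp' : ∀ s (hs : s ∈ S), f (p s hs) = s := by simpa [mem_pi] using hp
      have hinj : Injective fun s : S => p s.1 s.2 := by
        intro s s' h
        have := congrArg f h
        simp only [hp'] at this
        exact Subtype.ext this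
      simp only [mem_filter, mem_powersetCard, subset_univ, true_and]
      refine ⟨⟨?_, ?_⟩, ?_⟩
      · rw [card_image_of_injective _ hinj, card_attach]
        exact (mem_powersetCard.1 hS).2
      · intro v hv w hw hvw
        simp only [coe_image, Set.mem_image, mem_coe, mem_attach, true_and, Subtype.exists] at hv hw
        obtain ⟨s, hs, rfl⟩ := hv
        obtain ⟨s', hs', rfl⟩ := hw
        rw [hp', hp'] at hvw
        subst hvw
        rfl
      · rw [image_image]
        ext s
        simp [hp']
    · intro p hp p' hp' h
      have h1 : ∀ s (hs : s ∈ S), f (p s hs) = s := by simpa [mem_pi] using hp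
      have h2 : ∀ s (hs : s ∈ S), f (p' s hs) = s := by simpa [mem_pi] using hp'
      funext s hs
      have hmem : p s hs ∈ S.attach.image fun s => p' s.1 s.2 := by
        rw [← h]
        exact mem_image.2 ⟨⟨s, hs⟩, mem_attach _ _, rfl⟩
      obtain ⟨⟨s', hs'⟩, -, heq⟩ := mem_image.1 hmem
      have := congrArg f heq
      simp only [h1, h2] at this
      subst this
      exact heq.symm
    · intro U hU
      simp only [mem_filter, mem_powersetCard, subset_univ, true_and] at hU
      obtain ⟨⟨hUr, hinj⟩, rfl⟩ := hU
      have hex : ∀ s ∈ U.image f, ∃ v ∈ U, f v = s := fun s hs => by simpa using hs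
      choose p hpU hpf using hex
      refine ⟨p, by simpa [mem_pi] using hpf, ?_⟩
      ext v
      simp only [mem_image, mem_attach, true_and, Subtype.exists]
      constructor
      · rintro ⟨s, hs, rfl⟩
        exact hpU s (mem_image.2 hs)
      · intro hv
        have hs : f v ∈ U.image f := mem_image_of_mem f hv
        exact ⟨f v, mem_image.1 hs, hinj (hpU _ hs) hv (hpf _ hs)⟩
  · intro U hU
    simp only [coe_filter, Set.mem_ofPred_eq, mem_powersetCard, subset_univ, true_and] at hU
    simp only [mem_coe, mem_powersetCard, subset_univ, true_and]
    rw [card_image_of_injOn hU.2, hU.1]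

/-- The sizes of the parts of the Turán graph. -/
def turanPartSizes (n t : ℕ) : Multiset ℕ :=
  (univ : Finset (Fin t)).val.map fun s : Fin t => #{v : Fin n | (v : ℕ) % t = (s : ℕ)}

theorem card_turanPartSizes (n t : ℕ) : Multiset.card (turanPartSizes n t) = t := by
  simp [turanPartSizes]

theorem sum_turanPartSizes (n : ℕ) {t : ℕ} (ht : 0 < t) : (turanPartSizes n t).sum = n := by
  have h := card_eq_sum_card_fiberwise (s := (univ : Finset (Fin n)))
    (t := (univ : Finset (Fin t))) (f := fun v => ⟨v % t, Nat.mod_lt _ ht⟩)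
    (fun _ _ => by simp)
  simp only [card_univ, Fintype.card_fin, Fin.ext_iff] at h
  exact h.symm

theorem isBalanced_turanPartSizes (n t : ℕ) : (turanPartSizes n t).IsBalanced := by
  have key : ∀ x ∈ turanPartSizes n t, n / t ≤ x ∧ x ≤ n / t + 1 := by
    intro x hx
    simp only [turanPartSizes, Multiset.mem_map] at hx
    obtain ⟨s, -, rfl⟩ := hx
    have hcount := Nat.count_modEq_card n s.pos s
    rw [Nat.count_eq_card_filter_range] at hcount
    have : #{v : Fin n | (v : ℕ) % t = (s : ℕ)} = #{v ∈ range n | v ≡ s [MOD t]} := by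
      rw [← card_map Fin.valEmbedding]
      congr 1
      ext v
      simp only [mem_map, mem_filter, mem_univ, true_and, Fin.valEmbedding_apply, mem_range,
        Nat.ModEq, Nat.mod_eq_of_lt s.2]
      exact ⟨by rintro ⟨w, hw, rfl⟩; exact ⟨w.2, hw⟩, fun h => ⟨⟨v, h.1⟩, h.2, rfl⟩⟩
    rw [this, hcount]
    split_ifs <;> omega
  intro x hx y hy
  have := key x hx
  have := key y hy
  omega

/-- Cliques are the sets on which the residue mod `t` is injective. -/
theorem card_cliqueFinset_turanGraph (n r : ℕ) {t : ℕ} (ht : 0 < t) :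
    #((turanGraph n t).cliqueFinset r) = (turanPartSizes n t).esymm r := by
  rw [turanPartSizes, Finset.esymm_map_val]
  have h := card_filter_injOn_eq_sum_prod
    (fun v : Fin n => (⟨v % t, Nat.mod_lt _ ht⟩ : Fin t)) r
  simp only [Fin.ext_iff] at h
  rw [← h]
  congr 1
  ext U
  simp only [mem_cliqueFinset_iff, isNClique_iff, mem_filter, mem_powersetCard, subset_univ,
    true_and]
  rw [and_comm, and_congr_right_iff]
  intro _
  simp only [isClique_iff, Set.Pairwise, turanGraph_adj, Set.InjOn, Fin.mk.injEq]
  constructor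
  · intro h v hv w hw hvw
    by_contra hne
    exact h hv hw hne hvw
  · intro h v hv w hw hne hvw
    exact hne (h hv hw hvw)

end SimpleGraph

/-! ### Summing over color classes. -/

namespace ColoredTuran

open Finset SimpleGraph

/-- A `K_{t+1}`-free graph has at most as many edges, and at most as many `r`-cliques per edge, as the
Turán graph. -/
theorem card_cliqueFinset_mul_le {n t : ℕ} (ht : 0 < t) {G : SimpleGraph (Fin n)}
    [DecidableRel G.Adj] (hG : G.CliqueFree (t + 1)) (q : ℕ) :
    #(G.cliqueFinset 2) ≤ #((turanGraph n t).cliqueFinset 2) ∧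
      #(G.cliqueFinset (q + 2)) * #((turanGraph n t).cliqueFinset 2) ≤
        #(G.cliqueFinset 2) * #((turanGraph n t).cliqueFinset (q + 2)) := by
  simp only [card_cliqueFinset_turanGraph n _ ht]
  exact hG.card_cliqueFinset_le (isBalanced_turanPartSizes n t) (card_turanPartSizes n t)
    (by rw [sum_turanPartSizes n ht, Fintype.card_fin]) q

theorem sum_card_cliqueFinset_two_labelGraph_le {V K : Type*} [Fintype V] [DecidableEq V]
    [Fintype K] [DecidableEq K] {G : SimpleGraph V} [DecidableRel G.Adj] (c : G.EdgeLabeling K)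
    [∀ i, DecidableRel (c.labelGraph i).Adj] :
    ∑ i, #((c.labelGraph i).cliqueFinset 2) ≤ #(G.cliqueFinset 2) := by
  rw [← card_biUnion]
  · refine card_le_card (biUnion_subset.2 fun i _ S hS => ?_)
    rw [mem_cliqueFinset_iff] at hS ⊢
    exact hS.mono c.labelGraph_le
  · intro i _ j _ hij
    rw [Function.onFun, Finset.disjoint_left]
    intro S hi hj
    rw [mem_cliqueFinset_iff, isNClique_iff] at hi hj
    obtain ⟨u, v, huv, rfl⟩ := card_eq_two.1 hi.2
    have h1 := hi.1 (by simp : u ∈ _) (by simp : v ∈ _) huv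
    have h2 := hj.1 (by simp : u ∈ _) (by simp : v ∈ _) huv
    rw [EdgeLabeling.labelGraph_adj] at h1 h2
    obtain ⟨_, rfl⟩ := h1
    obtain ⟨_, h⟩ := h2
    exact hij h

theorem copyCount_completeGraph_one {V : Type*} [Fintype V] (G : SimpleGraph V) :
    G.copyCount (completeGraph (Fin 1)) = Fintype.card V := by
  classical
  rw [copyCount_top_eq_card_cliqueFinset, ← card_univ,
    ← card_map ⟨fun v => ({v} : Finset V), singleton_injective⟩]
  congr 1
  ext S
  simp only [mem_cliqueFinset_iff, isNClique_iff, mem_map, mem_univ, true_and,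
    Function.Embedding.coeFn_mk]
  constructor
  · rintro ⟨-, h⟩
    obtain ⟨v, rfl⟩ := card_eq_one.1 h
    exact ⟨v, rfl⟩
  · rintro ⟨v, rfl⟩
    simp

theorem copyCount_bot_completeGraph {V : Type*} [Fintype V] {r : ℕ} (hr : 2 ≤ r) :
    (⊥ : SimpleGraph V).copyCount (completeGraph (Fin r)) = 0 := by
  classical
  rw [copyCount_top_eq_card_cliqueFinset, card_eq_zero, cliqueFinset_eq_empty_iff]
  exact cliqueFree_bot hr

theorem labelGraph_monochromatic {k : ℕ} {V : Type*} (G : SimpleGraph V) (i j : Fin k) :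
    (monochromatic G i).labelGraph j = if j = i then G else ⊥ := by
  ext u v
  rw [EdgeLabeling.labelGraph_adj]
  split_ifs with h
  · simp [monochromatic, h]
  · simp [monochromatic, Ne.symm h]

/-- The unused colors contribute nothing only because `2 ≤ r j`; with `r j = 1` each would add the
number of vertices. -/
theorem coloredCount_monochromatic {k : ℕ} {V : Type*} [Fintype V] (G : SimpleGraph V)
    {r : Fin k → ℕ} (hr : ∀ i, 2 ≤ r i) (i : Fin k) :
    coloredCount (fun j => completeGraph (Fin (r j))) (monochromatic G i) =
      G.copyCount (completeGraph (Fin (r i))) := by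
  rw [coloredCount, sum_eq_single i]
  · rw [labelGraph_monochromatic, if_pos rfl]
  · intro j _ hj
    rw [labelGraph_monochromatic, if_neg hj, copyCount_bot_completeGraph (hr j)]
  · simp

theorem sum_copyCount_labelGraph_le {n t : ℕ} (ht : 0 < t) {K : Type*} [Fintype K]
    [DecidableEq K] {G : SimpleGraph (Fin n)} (hG : G.CliqueFree (t + 1)) (c : G.EdgeLabeling K)
    (r : K → ℕ) (s : Finset K) (hr : ∀ j ∈ s, 2 ≤ r j) (i : K)
    (hmax : ∀ j ∈ s, (turanGraph n t).copyCount (completeGraph (Fin (r j))) ≤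
      (turanGraph n t).copyCount (completeGraph (Fin (r i)))) :
    ∑ j ∈ s, (c.labelGraph j).copyCount (completeGraph (Fin (r j))) ≤
      (turanGraph n t).copyCount (completeGraph (Fin (r i))) := by
  classical
  simp only [copyCount_top_eq_card_cliqueFinset] at hmax ⊢
  have hfree : ∀ j, (c.labelGraph j).CliqueFree (t + 1) := fun j =>
    hG.anti c.labelGraph_le
  have hE := (card_cliqueFinset_mul_le ht hG 0).1
  have hsum := sum_card_cliqueFinset_two_labelGraph_le c
  set T := #((turanGraph n t).cliqueFinset 2) with hT
  set M := #((turanGraph n t).cliqueFinset (r i)) with hM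
  have hcol : ∀ j ∈ s, #((c.labelGraph j).cliqueFinset (r j)) * T ≤
      #((c.labelGraph j).cliqueFinset 2) * M := by
    intro j hj
    obtain ⟨q, hq⟩ := Nat.exists_eq_add_of_le' (hr j hj)
    have h := (card_cliqueFinset_mul_le ht (hfree j) q).2
    rw [← hq] at h
    exact h.trans (Nat.mul_le_mul_left _ (hmax j hj))
  -- If `T = 0`, division by `T` is impossible, but then every color class is edgeless.
  rcases Nat.eq_zero_or_pos T with h0 | hpos
  · rw [sum_eq_zero]
    · exact Nat.zero_le _
    intro j hj
    have h2 : (c.labelGraph j).CliqueFree 2 := by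
      rw [← cliqueFinset_eq_empty_iff, ← card_eq_zero]
      have := (card_cliqueFinset_mul_le ht (hfree j) 0).1
      omega
    rw [card_eq_zero, cliqueFinset_eq_empty_iff]
    exact h2.mono (hr j hj)
  · refine Nat.le_of_mul_le_mul_right ?_ hpos
    calc _ = ∑ j ∈ s, #((c.labelGraph j).cliqueFinset (r j)) * T := sum_mul _ _ _
      _ ≤ ∑ j ∈ s, #((c.labelGraph j).cliqueFinset 2) * M := sum_le_sum hcol
      _ ≤ ∑ j, #((c.labelGraph j).cliqueFinset 2) * M :=
        sum_le_sum_of_subset (subset_univ s)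
      _ = (∑ j, #((c.labelGraph j).cliqueFinset 2)) * M := (sum_mul _ _ _).symm
      _ ≤ T * M := Nat.mul_le_mul_right _ (hsum.trans hE)
      _ = M * T := mul_comm _ _

theorem exists_forall_coloredCount_le {k n t : ℕ} (hk : 1 ≤ k) (ht : 0 < t) (r : Fin k → ℕ)
    (hr : ∀ i, 1 ≤ r i) :
    ∃ i : Fin k, ∀ (G : SimpleGraph (Fin n)) (c : G.EdgeLabeling (Fin k)),
      G.CliqueFree (t + 1) →
      coloredCount (fun j => completeGraph (Fin (r j))) c ≤
        coloredCount (fun j => completeGraph (Fin (r j)))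
          (monochromatic (turanGraph n t) i) := by
  -- Copies of `K_1` are vertices, so these colors contribute equally to both sides.
  have hone : ∀ (G G' : SimpleGraph (Fin n)) (j : Fin k), ¬ 2 ≤ r j →
      G.copyCount (completeGraph (Fin (r j))) = G'.copyCount (completeGraph (Fin (r j))) := by
    intro G G' j hj
    have h : r j = 1 := by have := hr j; omega
    rw [h, copyCount_completeGraph_one, copyCount_completeGraph_one]
  rcases ({j | 2 ≤ r j} : Finset (Fin k)).eq_empty_or_nonempty with hs | hs
  · refine ⟨⟨0, hk⟩, fun G c _ => sum_le_sum fun j _ => (hone _ _ j ?_).le⟩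
    simpa using filter_eq_empty_iff.1 hs (mem_univ j)
  · obtain ⟨i, hi, hmax⟩ := exists_max_image _
      (fun j => (turanGraph n t).copyCount (completeGraph (Fin (r j)))) hs
    refine ⟨i, fun G c hG => ?_⟩
    simp only [coloredCount]
    rw [← sum_filter_add_sum_filter_not univ (fun j => 2 ≤ r j),
      ← sum_filter_add_sum_filter_not univ (fun j => 2 ≤ r j) fun j =>
        copyCount ((monochromatic (turanGraph n t) i).labelGraph j) _]
    refine add_le_add ?_ (sum_le_sum fun j hj => (hone _ _ j (mem_filter.1 hj).2).le)
    refine (sum_copyCount_labelGraph_le ht hG c r _ (fun j hj => (mem_filter.1 hj).2) i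
      hmax).trans ?_
    refine le_of_eq_of_le ?_ (single_le_sum (fun _ _ => Nat.zero_le _) hi)
    rw [labelGraph_monochromatic, if_pos rfl]

end ColoredTuran

theorem mainTheorem1 (k n m : ℕ) (hk : 1 ≤ k) (hm : 2 ≤ m) (r : Fin k → ℕ) (hr : ∀ i, 1 ≤ r i) :
    (∃ i : Fin k,
      (SimpleGraph.completeGraph (Fin m)).Free (SimpleGraph.turanGraph n (m - 1)) ∧
      ∀ (G : SimpleGraph (Fin n)) (c : G.EdgeLabeling (Fin k)),
        (SimpleGraph.completeGraph (Fin m)).Free G →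
        ColoredTuran.coloredCount (fun j => SimpleGraph.completeGraph (Fin (r j))) c ≤
          ColoredTuran.coloredCount (fun j => SimpleGraph.completeGraph (Fin (r j)))
            (ColoredTuran.monochromatic (SimpleGraph.turanGraph n (m - 1)) i)) ∧
    ((∀ i, 2 ≤ r i) →
      ColoredTuran.IsColorResistant n (fun j => SimpleGraph.completeGraph (Fin (r j)))
        (SimpleGraph.completeGraph (Fin m))) := by
  obtain ⟨t, rfl⟩ : ∃ t, m = t + 1 := ⟨m - 1, by omega⟩
  have ht : 0 < t := by omega
  rw [Nat.add_sub_cancel]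
  have hfree : ∀ G : SimpleGraph (Fin n),
      (SimpleGraph.completeGraph (Fin (t + 1))).Free G ↔ G.CliqueFree (t + 1) := fun G => by
    rw [SimpleGraph.Free, ← SimpleGraph.not_cliqueFree_iff_top_isContained, not_not]
  have hT := (hfree _).2 (SimpleGraph.turanGraph_cliqueFree (n := n) ht)
  obtain ⟨i, hi⟩ := ColoredTuran.exists_forall_coloredCount_le (n := n) hk ht r hr
  refine ⟨⟨i, hT, fun G c hG => hi G c ((hfree G).1 hG)⟩, fun hr2 => ?_⟩
  have hcbdd := (ColoredTuran.cexValues_finite n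
    (fun j => SimpleGraph.completeGraph (Fin (r j)))
    (SimpleGraph.completeGraph (Fin (t + 1)))).bddAbove
  refine le_antisymm ?_ (Finset.sup_le fun j _ => ?_)
  · refine le_trans ?_ (Finset.le_sup (Finset.mem_univ i))
    refine csSup_le ⟨_, _, ColoredTuran.monochromatic _ i, hT, rfl⟩ ?_
    rintro x ⟨G, c, hG, rfl⟩
    refine (hi G c ((hfree G).1 hG)).trans ?_
    rw [ColoredTuran.coloredCount_monochromatic _ hr2]
    exact le_csSup (ColoredTuran.exValues_finite _ _ _).bddAbove ⟨_, hT, rfl⟩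
  · refine csSup_le ⟨_, _, hT, rfl⟩ ?_
    rintro x ⟨G, hG, rfl⟩
    exact le_csSup hcbdd ⟨G, ColoredTuran.monochromatic G j, hG,
      ColoredTuran.coloredCount_monochromatic G hr2 j⟩
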